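/- Let $n, m \ge 1$ be integers and $\varepsilon > 0$. For a hidden string $a \in \{0,1\}^n$, an *inner product query with bias $\varepsilon$* is a unitary $U_{IP}$ on $n+m$ qubits such that (1) if $x \in \{0,1\}^n$ is chosen uniformly at random and the last qubit of $U_{IP}|x\rangle|0^m\rangle$ is measured with outcome $w$, then $\Pr[w = a\cdot x] \ge \frac12 + \varepsilon$, where $a \cdot x$ is the inner product modulo two, and (2) for all $x \in \{0,1\}^n$, $y \in \{0,1\}^m$, the state of the first $n$ qubits of $U_{IP}|x\rangle|y\rangle$ is $|x\rangle$. The *equivalence query* $U_{EQ}$ maps $|x\rangle|b\rangle$ to $|x\rangle|\bar b\rangle$ if $x = a$ and to $|x\rangle|b\rangle$ if $x \ne a$. In the quantum GL problem, $a$ is to be determined by a quantum circuit that starts in an all-zero state, has access to $a$ only through applications of $U_{IP}$, $U_{IP}^\dagger$ and $U_{EQ}$, and ends with a measurement in the computational basis; its other gates, called auxiliary qubit operations, are arbitrary unitary gates on at most two qubits. **Theorem.** For every constant $p < 1$ there is a constant $K > 0$ such that, for all $n, m \ge 1$ and $\varepsilon > 0$, there is such a circuit (depending on $n$, $m$, $\varepsilon$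 and $p$ only) that uses at most $K/\varepsilon$ queries $U_{IP}$, $U_{IP}^\dagger$ and $U_{EQ}$ in total and at most $K(n+m)/\varepsilon$ auxiliary qubit operations, and that outputs $a$ with probability at least $p$, for every $a \in \{0,1\}^n$ and every inner product query $U_{IP}$ with bias $\varepsilon$ for $a$. In particular, when the number $m$ of work qubits of $U_{IP}$ is $O(n)$, the number of auxiliary qubit operations is $O(n/\varepsilon)$. -/

import Mathlib

open scoped Matrix

/-- Computational basis states of a register of qubits labelled by `Q`. -/
abbrev Bits (Q : Type) : Type := Q → Bool

/-- Operators on the register of qubits labelled by `Q`, as matrices in the computational basis;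
the entry `M z' z` is the amplitude of `z'` in the image of the basis state `z`. -/
abbrev QOp (Q : Type) : Type := Matrix (Bits Q) (Bits Q) ℂ

/-- The inner product of two bit strings modulo two. -/
def bitInner {n : ℕ} (a x : Bits (Fin n)) : Bool :=
  decide (Odd (Finset.univ.filter (fun i => a i = true ∧ x i = true)).card)

/-- The operator on the qubits `Q` which applies `M` to the qubits selected by `e` and acts as the
identity on all other qubits. -/
def onWires {ι Q : Type} [Fintype ι] [Fintype Q] [DecidableEq Q] (e : ι ↪ Q) (M : QOp ι) : QOp Q :=
  Matrix.of fun z' z =>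
    if ∀ q, (∀ i, e i ≠ q) → z' q = z q then M (fun i => z' (e i)) (fun i => z (e i)) else 0

/-- `U` is a quantum inner product query with bias `ε` for the hidden string `a`: a unitary operator
on `n + m` qubits, where `Fin n` labels the first `n` qubits and `Fin m` the last `m` ones. -/
structure IsIPQuery {n m : ℕ} (hm : 0 < m) (ε : ℝ) (a : Bits (Fin n))
    (U : QOp (Fin n ⊕ Fin m)) : Prop where
  /-- `U` is unitary. -/
  unitary : U ∈ Matrix.unitaryGroup (Bits (Fin n ⊕ Fin m)) ℂ
  /-- If the last qubit of `U |x⟩|0^m⟩` is measured, for a uniformly random `x`, then the outcome is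
  the inner product of `a` and `x` with probability at least `1/2 + ε`. -/
  bias : 1 / 2 + ε ≤ (1 / 2 ^ n : ℝ) * ∑ x : Bits (Fin n),
    ∑ z ∈ Finset.univ.filter
        (fun z : Bits (Fin n ⊕ Fin m) => z (Sum.inr ⟨m - 1, Nat.sub_one_lt_of_lt hm⟩) = bitInner a x),
      ‖U z (Sum.elim x (fun _ => false))‖ ^ 2
  /-- For all `x` and `y`, the state of the first `n` qubits of `U |x⟩|y⟩` is `|x⟩`. -/
  control : ∀ (x : Bits (Fin n)) (y : Bits (Fin m)) (z : Bits (Fin n ⊕ Fin m)),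
    (fun i => z (Sum.inl i)) ≠ x → U z (Sum.elim x y) = 0

/-- The quantum equivalence query for `a`, an operator on `n + 1` qubits:
`|x⟩|b⟩ ↦ |x⟩|¬b⟩` if `x = a`, and `|x⟩|b⟩ ↦ |x⟩|b⟩` otherwise. -/
def eqQuery {n : ℕ} (a : Bits (Fin n)) : QOp (Fin n ⊕ Fin 1) :=
  Matrix.of fun z' z =>
    if z' = Sum.elim (fun i => z (Sum.inl i))
        (fun j => if (fun i => z (Sum.inl i)) = a then !z (Sum.inr j) else z (Sum.inr j))
    then 1 else 0

/-- One step of a quantum query algorithm on `N` qubits: an auxiliary operation, which is an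
arbitrary unitary gate on at most two qubits, or one of the three kinds of black-box queries,
applied to distinct qubits chosen by the algorithm. -/
inductive Step (n m N : ℕ) : Type
  /-- A unitary gate on at most two qubits. -/
  | gate (k : ℕ) (hk : k ≤ 2) (V : Matrix.unitaryGroup (Bits (Fin k)) ℂ) (e : Fin k ↪ Fin N)
  /-- An inner product query. -/
  | ip (e : Fin n ⊕ Fin m ↪ Fin N)
  /-- An inverse inner product query. -/
  | ipInv (e : Fin n ⊕ Fin m ↪ Fin N)
  /-- An equivalence query. -/
  | eq (e : Fin n ⊕ Fin 1 ↪ Fin N)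

namespace Step

variable {n m N : ℕ}

/-- The operator performed by a step when the black boxes hold the inner product query `U` and the
string `a`. -/
def op (U : QOp (Fin n ⊕ Fin m)) (a : Bits (Fin n)) : Step n m N → QOp (Fin N)
  | gate _ _ V e => onWires e V.1
  | ip e => onWires e U
  | ipInv e => onWires e Uᴴ
  | eq e => onWires e (eqQuery a)

/-- Whether a step is a query to a black box. -/
def isQuery : Step n m N → Bool
  | gate _ _ _ _ => false
  | ip _ => true
  | ipInv _ => true
  | eq _ => true

end Step

/-- A quantum query algorithm for black boxes with parameters `n` and `m`: a circuit, which has no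
access to the hidden string and to the inner product query other than through query steps. All
its qubits start in state `|0⟩`, the steps are performed in the order of the list, and finally the
qubits `output` are measured in the computational basis. -/
structure QueryAlgorithm (n m : ℕ) : Type where
  /-- The number of qubits. -/
  N : ℕ
  /-- The steps of the circuit, the first one at the head. -/
  steps : List (Step n m N)
  /-- The qubits that are measured at the end. -/
  output : Fin n ↪ Fin N

namespace QueryAlgorithm

variable {n m : ℕ}

/-- The amplitudes of the final state. -/
def finalState (A : QueryAlgorithm n m) (U : QOp (Fin n ⊕ Fin m)) (a : Bits (Fin n)) :
    Bits (Fin A.N) → ℂ :=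
  A.steps.foldl (fun ψ s => s.op U a *ᵥ ψ) (Pi.single (fun _ => false) 1)

/-- The probability that the measured output is the hidden string `a`. -/
noncomputable def successProb (A : QueryAlgorithm n m) (U : QOp (Fin n ⊕ Fin m))
    (a : Bits (Fin n)) : ℝ :=
  ∑ z ∈ Finset.univ.filter (fun z : Bits (Fin A.N) => (fun i => z (A.output i)) = a),
    ‖A.finalState U a z‖ ^ 2

/-- The total number of queries. -/
def queryCount (A : QueryAlgorithm n m) : ℕ :=
  A.steps.countP (fun s => s.isQuery)

/-- The number of auxiliary qubit operations, that is, of gates on at most two qubits. -/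
def auxCount (A : QueryAlgorithm n m) : ℕ :=
  A.steps.countP (fun s => !s.isQuery)

end QueryAlgorithm

/-! ### Operators on selected qubits, and qubits left unchanged. -/

section OnWires

variable {ι κ Q : Type} [Fintype ι] [Fintype κ] [Fintype Q] [DecidableEq Q]

/-! The base circuit is Hadamards on the first `n` qubits, `U`, a sign on the last qubit, `U†`, and
Hadamards again. Since `U` preserves `x`, the amplitude of the state with `a` in the first `n`
qubits and zeros in the last `m` is the average over `x` of Pr[correct] - Pr[wrong]. It is real and
at least `2ε` (`baseOp_apply`), so the failure probability is at most `1 - 4ε²` (`failProb_base`).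

This is boosted by nested amplitude amplification, each level using the circuit `V` of the previous
one three times: `V`, a phase `ω` on the states showing `a`, `V†`, a phase `ω` on the all-zero
state, `V`. If `(1 - ω)² = -rω`, the failure probability changes from `F` to `(1 - r(1 - F))² F`
(`failProb_amplification`).

The true `F` is unknown; only an upper bound is available, and ordinary Grover iterations could
overshoot. The phases are therefore tuned to a known `c ≥ 1` with `c²F ≤ 1`. For `r = 4c²/(4c² - 3)`
the new value `F'` satisfies `T₃(c)² F' = T₃(c√F)² ≤ 1`, where `T₃(x) = 4x³ - 3x` is the Chebyshev
polynomial (`amplification_bound`). As `T₃(cosh t) = cosh 3t`, starting from `c = cosh ε` gives `F ≤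
1 / cosh²(3ᵏε)` after `k` levels (`failProb_amplified`). The phases depend on `ε` and the level
only, as a fixed circuit requires.

A constant value of `3ᵏε` suffices, so about `3ᵏ = O(1/ε)` copies of the base circuit are used. The
phase on the hidden string costs two equivalence queries and one gate; the phase on zero costs `O(n
+ m)` gates, through a ladder of disjunctions on auxiliary qubits. -/

theorem onWires_mulVec [DecidableEq ι] (e : ι ↪ Q) (M : QOp ι) (ψ : Bits Q → ℂ) (z : Bits Q) :
    (onWires e M *ᵥ ψ) z = ∑ y, M (fun i => z (e i)) y * ψ (Function.extend e y z) := by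
  simp only [Matrix.mulVec, dotProduct, onWires, Matrix.of_apply, ite_mul, zero_mul]
  rw [← Finset.sum_filter]
  symm
  refine Finset.sum_bij' (fun y _ => Function.extend e y z) (fun w _ i => w (e i)) ?_ ?_ ?_ ?_ ?_
  · intro y _
    simp only [Finset.mem_filter, Finset.mem_univ, true_and]
    intro q hq
    rw [Function.extend_apply' _ _ _ (by simpa using hq)]
  · simp
  · intro y _
    funext i
    exact e.injective.extend_apply _ _ _
  · intro w hw
    simp only [Finset.mem_filter, Finset.mem_univ, true_and] at hw
    funext q
    by_cases h : ∃ i, e i = q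
    · obtain ⟨i, rfl⟩ := h
      exact e.injective.extend_apply _ _ _
    · rw [Function.extend_apply' _ _ _ h]
      exact hw q (by simpa using h)
  · intro y _
    simp only [e.injective.extend_apply]

theorem extend_extend {ι Q : Type} (e : ι ↪ Q) (y y' : Bits ι) (z : Bits Q) :
    Function.extend e y (Function.extend e y' z) = Function.extend e y z := by
  funext q
  by_cases h : ∃ i, e i = q
  · obtain ⟨i, rfl⟩ := h
    simp only [e.injective.extend_apply]
  · simp only [Function.extend_apply' _ _ _ h]

theorem onWires_mul [DecidableEq ι] (e : ι ↪ Q) (A B : QOp ι) :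
    onWires e (A * B) = onWires e A * onWires e B := by
  refine Matrix.ext_of_mulVec_single fun z => ?_
  rw [← Matrix.mulVec_mulVec]
  funext w
  simp only [onWires_mulVec, extend_extend, e.injective.extend_apply, Matrix.mul_apply,
    Finset.sum_mul, Finset.mul_sum, mul_assoc]
  exact Finset.sum_comm

theorem onWires_one [DecidableEq ι] (e : ι ↪ Q) : onWires e (1 : QOp ι) = 1 := by
  ext z' z
  simp only [onWires, Matrix.of_apply, Matrix.one_apply]
  rw [← ite_and]
  refine if_congr ⟨fun h => ?_, fun h => by simp [h]⟩ rfl rfl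
  funext q
  by_cases hq : ∃ i, e i = q
  · obtain ⟨i, rfl⟩ := hq
    exact congrFun h.2 i
  · exact h.1 q (by simpa using hq)

theorem onWires_conjTranspose (e : ι ↪ Q) (A : QOp ι) : onWires e Aᴴ = (onWires e A)ᴴ := by
  ext z' z
  simp only [onWires, Matrix.of_apply, Matrix.conjTranspose_apply, apply_ite star, star_zero]
  exact if_congr (by simp only [eq_comm]) rfl rfl

theorem onWires_mem_unitaryGroup [DecidableEq ι] (e : ι ↪ Q) {A : QOp ι}
    (hA : A ∈ Matrix.unitaryGroup (Bits ι) ℂ) :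
    onWires e A ∈ Matrix.unitaryGroup (Bits Q) ℂ := by
  rw [Matrix.mem_unitaryGroup_iff, Matrix.star_eq_conjTranspose, ← onWires_conjTranspose,
    ← onWires_mul, ← Matrix.star_eq_conjTranspose, Matrix.mem_unitaryGroup_iff.1 hA, onWires_one]

/-- Lets a one-qubit gate of the whole circuit be regarded as an operator inside the data register,
where the base circuit is analysed. -/
theorem onWires_trans [DecidableEq ι] (e' : κ ↪ ι) (e : ι ↪ Q) (A : QOp κ) :
    onWires (e'.trans e) A = onWires e (onWires e' A) := by
  ext z' z
  simp only [onWires, Matrix.of_apply, Function.Embedding.trans_apply]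
  rw [← ite_and]
  refine if_congr ⟨fun h => ⟨fun q hq => h q fun i => hq _, fun j hj => h _ fun i hi => ?_⟩,
    fun h q hq => ?_⟩ rfl rfl
  · exact hj i (e.injective hi)
  · by_cases hq' : ∃ i, e i = q
    · obtain ⟨i, rfl⟩ := hq'
      exact h.2 i fun j hj => hq j (by rw [hj])
    · exact h.1 q (by simpa using hq')

/-- `M` does not change the values of the qubits in `T`. -/
def FixesWires {Q : Type} (T : Set Q) (M : QOp Q) : Prop :=
  ∀ z' z : Bits Q, (∃ q ∈ T, z' q ≠ z q) → M z' z = 0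

theorem FixesWires.mul {T : Set Q} {A B : QOp Q} (hA : FixesWires T A) (hB : FixesWires T B) :
    FixesWires T (A * B) := by
  rintro z' z ⟨q, hq, h⟩
  rw [Matrix.mul_apply]
  refine Finset.sum_eq_zero fun w _ => ?_
  by_cases hw : z' q = w q
  · rw [hB w z ⟨q, hq, hw ▸ h⟩, mul_zero]
  · rw [hA z' w ⟨q, hq, hw⟩, zero_mul]

theorem FixesWires.conjTranspose {Q : Type} {T : Set Q} {A : QOp Q} (hA : FixesWires T A) :
    FixesWires T Aᴴ := by
  rintro z' z ⟨q, hq, h⟩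
  rw [Matrix.conjTranspose_apply, hA z z' ⟨q, hq, h.symm⟩, star_zero]

theorem fixesWires_diagonal {Q : Type} [DecidableEq (Bits Q)] (T : Set Q) (d : Bits Q → ℂ) :
    FixesWires T (Matrix.diagonal d) := by
  rintro z' z ⟨q, _, h⟩
  exact Matrix.diagonal_apply_ne _ fun hz => h (congrFun hz q)

theorem fixesWires_onWires {T : Set Q} (e : ι ↪ Q) (h : ∀ i, e i ∉ T) (M : QOp ι) :
    FixesWires T (onWires e M) := by
  rintro z' z ⟨q, hq, hz⟩
  rw [onWires, Matrix.of_apply, if_neg]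
  exact fun H => hz (H q fun i hi => h i (hi ▸ hq))

/-- Clean auxiliary qubits stay clean: such an operator does not mix different values of the qubits
in `T`. -/
theorem FixesWires.mulVec_eq_zero {T : Set Q} {A : QOp Q} (hA : FixesWires T A) {ψ : Bits Q → ℂ}
    (hψ : ∀ z, (∃ q ∈ T, z q = true) → ψ z = 0) (z : Bits Q) (hz : ∃ q ∈ T, z q = true) :
    (A *ᵥ ψ) z = 0 := by
  obtain ⟨q, hq, h⟩ := hz
  refine Finset.sum_eq_zero fun w _ => ?_
  by_cases hw : w q = true
  · rw [hψ w ⟨q, hq, hw⟩, mul_zero]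
  · exact mul_eq_zero_of_left (hA z w ⟨q, hq, fun h' => hw (h' ▸ h)⟩) _

end OnWires

/-! ### Elementary gates, and the disjunction gate built from two-qubit gates. -/

section Gates

variable {Q : Type} [Fintype Q] [DecidableEq Q]

/-- The qubit `q` as a register with one qubit. -/
def wire {Q : Type} (q : Q) : Fin 1 ↪ Q := ⟨fun _ => q, fun _ _ _ => Subsingleton.elim _ _⟩

/-- The distinct qubits `p` and `q` as a register with two qubits. -/
def wirePair {Q : Type} {p q : Q} (h : p ≠ q) : Fin 2 ↪ Q :=
  ⟨![p, q], by intro i j; fin_cases i <;> fin_cases j <;> simp [h, h.symm]⟩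

/-- A matrix in the basis of a single qubit as an operator on a register with one qubit. -/
def oneQubit (A : Matrix Bool Bool ℂ) : QOp (Fin 1) := A.submatrix (fun y => y 0) (fun y => y 0)

theorem oneQubit_mem_unitaryGroup {A : Matrix Bool Bool ℂ} (hA : A ∈ Matrix.unitaryGroup Bool ℂ) :
    oneQubit A ∈ Matrix.unitaryGroup (Bits (Fin 1)) ℂ := by
  rw [Matrix.mem_unitaryGroup_iff] at hA ⊢
  rw [Matrix.star_eq_conjTranspose] at hA ⊢
  rw [oneQubit, Matrix.conjTranspose_submatrix]
  change A.submatrix (Equiv.funUnique (Fin 1) Bool) (Equiv.funUnique (Fin 1) Bool) *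
    Aᴴ.submatrix (Equiv.funUnique (Fin 1) Bool) (Equiv.funUnique (Fin 1) Bool) = 1
  rw [Matrix.submatrix_mul_equiv, hA, Matrix.submatrix_one_equiv]

theorem onWires_wire_mulVec (q : Q) (A : Matrix Bool Bool ℂ) (ψ : Bits Q → ℂ) (z : Bits Q) :
    (onWires (wire q) (oneQubit A) *ᵥ ψ) z = ∑ b, A (z q) b * ψ (Function.update z q b) := by
  rw [onWires_mulVec]
  refine Fintype.sum_equiv (Equiv.funUnique (Fin 1) Bool) _ _ fun y => ?_
  have : Function.extend (wire q) y z = Function.update z q (y 0) := by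
    funext r
    by_cases h : r = q
    · subst h
      rw [Function.update_self]
      exact (wire r).injective.extend_apply y z 0
    · rw [Function.update_of_ne h, Function.extend_apply']
      rintro ⟨i, hi⟩
      exact h hi.symm
  rw [this]
  rfl

/-- The two-qubit operator that applies `A` to the second qubit if the first one is `1`. -/
def controlled (A : Matrix Bool Bool ℂ) : QOp (Fin 2) :=
  Matrix.of fun y' y =>
    if y' 0 = y 0 then (if y 0 then A (y' 1) (y 1) else if y' 1 = y 1 then 1 else 0) else 0

theorem sum_bits_two (f : Bits (Fin 2) → ℂ) : ∑ y, f y = ∑ b, ∑ c, f ![b, c] := by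
  rw [← Fintype.sum_prod_type' (f := fun b c => f ![b, c])]
  exact Fintype.sum_equiv (finTwoArrowEquiv Bool) _ _ fun y => by
    congr 1; funext i; fin_cases i <;> rfl

theorem controlled_mem_unitaryGroup {A : Matrix Bool Bool ℂ}
    (hA : A ∈ Matrix.unitaryGroup Bool ℂ) :
    controlled A ∈ Matrix.unitaryGroup (Bits (Fin 2)) ℂ := by
  have h : ∀ c b' b : Bool, (∑ d, (if c then A b' d else if b' = d then 1 else 0) *
      star (if c then A b d else if b = d then 1 else 0)) =
      (1 : Matrix Bool Bool ℂ) b' b := by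
    intro c b' b
    cases c
    · simp [Matrix.one_apply]
    · rw [← Matrix.mem_unitaryGroup_iff.1 hA, Matrix.mul_apply]
      rfl
  rw [Matrix.mem_unitaryGroup_iff, Matrix.star_eq_conjTranspose]
  ext y' y
  rw [Matrix.mul_apply, sum_bits_two]
  have h2 : (1 : QOp (Fin 2)) y' y =
      if y' 0 = y 0 then (1 : Matrix Bool Bool ℂ) (y' 1) (y 1) else 0 := by
    rw [Matrix.one_apply, Matrix.one_apply, ← ite_and]
    refine if_congr ⟨fun h => by simp [h], fun h => ?_⟩ rfl rfl
    funext i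
    fin_cases i
    exacts [h.1, h.2]
  rw [h2, ← h (y 0)]
  simp only [controlled, Matrix.conjTranspose_apply, Matrix.of_apply, Matrix.cons_val_zero,
    Matrix.cons_val_one]
  rw [Finset.sum_eq_single (y 0)]
  · by_cases h : y' 0 = y 0
    · cases h3 : y 0 <;> cases y' 1 <;> cases y 1 <;> simp [h, h3]
    · simp [h]
  · intro b _ hb
    simp [Ne.symm hb]
  · simp

theorem onWires_wirePair_mulVec {p q : Q} (h : p ≠ q) (A : Matrix Bool Bool ℂ) (ψ : Bits Q → ℂ)
    (z : Bits Q) :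
    (onWires (wirePair h) (controlled A) *ᵥ ψ) z =
      if z p then ∑ b, A (z q) b * ψ (Function.update z q b) else ψ z := by
  have hext : ∀ b c, Function.extend (wirePair h) ![b, c] z =
      Function.update (Function.update z p b) q c := by
    intro b c
    funext r
    by_cases hr : ∃ i, wirePair h i = r
    · obtain ⟨i, rfl⟩ := hr
      rw [(wirePair h).injective.extend_apply]
      fin_cases i
      · exact (Function.update_of_ne h _ _).symm ▸ (Function.update_self p b z).symm
      · exact (Function.update_self (β := fun _ => Bool) q c _).symm
    · rw [Function.extend_apply' _ _ _ hr, Function.update_of_ne, Function.update_of_ne]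
      · exact fun hp => hr ⟨0, hp.symm⟩
      · exact fun hp => hr ⟨1, hp.symm⟩
  rw [onWires_mulVec, sum_bits_two]
  simp only [hext]
  rw [Finset.sum_eq_single (z p)]
  · have h0 : wirePair h 0 = p := rfl
    have h1 : wirePair h 1 = q := rfl
    simp only [controlled, Matrix.of_apply, Matrix.cons_val_zero, Matrix.cons_val_one, h0, h1,
      Function.update_eq_self, if_true]
    by_cases hz : z p = true
    · simp [hz]
    · rw [Bool.not_eq_true] at hz
      simp only [hz, Bool.false_eq_true, if_false]
      simp
  · intro b _ hb
    have h0 : wirePair h 0 = p := rfl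
    simp [controlled, h0, Ne.symm hb]
  · simp

/-- The Pauli matrix `X`. -/
def pauliX : Matrix Bool Bool ℂ := Matrix.of fun b' b => if b' = b then 0 else 1

/-- A square root of the Pauli matrix `X`. -/
noncomputable def sqrtX : Matrix Bool Bool ℂ :=
  Matrix.of fun b' b => if b' = b then (1 + Complex.I) / 2 else (1 - Complex.I) / 2

/-- The Hadamard matrix. -/
noncomputable def hadamard : Matrix Bool Bool ℂ :=
  Matrix.of fun b' b => (Real.sqrt 2 : ℂ)⁻¹ * if b' && b then -1 else 1

theorem pauliX_mem_unitaryGroup : pauliX ∈ Matrix.unitaryGroup Bool ℂ := by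
  rw [Matrix.mem_unitaryGroup_iff]
  ext b' b
  cases b' <;> cases b <;> simp [pauliX, Matrix.mul_apply]

theorem sqrtX_mem_unitaryGroup : sqrtX ∈ Matrix.unitaryGroup Bool ℂ := by
  rw [Matrix.mem_unitaryGroup_iff]
  ext b' b
  cases b' <;> cases b <;> simp [sqrtX, Matrix.mul_apply] <;> ring_nf <;>
    simp [map_ofNat] <;> norm_num

theorem hadamard_mem_unitaryGroup : hadamard ∈ Matrix.unitaryGroup Bool ℂ := by
  have h : ((Real.sqrt 2 : ℂ)⁻¹) * (Real.sqrt 2 : ℂ)⁻¹ = 1 / 2 := by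
    rw [← mul_inv, ← Complex.ofReal_mul, Real.mul_self_sqrt (by norm_num)]
    norm_num
  rw [Matrix.mem_unitaryGroup_iff]
  ext b' b
  cases b' <;> cases b <;> (simp [hadamard, Matrix.mul_apply, h]; try norm_num)

theorem diagonal_mem_unitaryGroup {B : Type} [Fintype B] [DecidableEq B] {d : B → ℂ}
    (hd : ∀ b, ‖d b‖ = 1) : Matrix.diagonal d ∈ Matrix.unitaryGroup B ℂ := by
  rw [Matrix.mem_unitaryGroup_iff, Matrix.star_eq_conjTranspose, Matrix.diagonal_conjTranspose,
    Matrix.diagonal_mul_diagonal, ← Matrix.diagonal_one]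
  congr 1
  funext b
  simp [Complex.mul_conj, Complex.normSq_eq_norm_sq, hd]

theorem onWires_wire_diagonal (q : Q) (d : Bool → ℂ) :
    onWires (wire q) (oneQubit (Matrix.diagonal d)) = Matrix.diagonal fun z => d (z q) := by
  refine Matrix.ext_of_mulVec_single fun w => ?_
  funext z
  rw [onWires_wire_mulVec, Matrix.mulVec_diagonal]
  simp [Matrix.diagonal_apply]

/-- The operator with action `ψ ↦ ψ ∘ f`. -/
def pullback (f : Bits Q → Bits Q) : QOp Q := Matrix.of fun z' z => if z = f z' then 1 else 0

theorem pullback_mulVec (f : Bits Q → Bits Q) (ψ : Bits Q → ℂ) (z : Bits Q) :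
    (pullback f *ᵥ ψ) z = ψ (f z) := by
  simp [pullback, Matrix.mulVec, dotProduct]

theorem eq_pullback {f : Bits Q → Bits Q} {M : QOp Q}
    (h : ∀ ψ z, (M *ᵥ ψ) z = ψ (f z)) : M = pullback f :=
  Matrix.ext_of_mulVec_single fun w => funext fun z => by rw [h, pullback_mulVec]

/-- The compute, phase, uncompute pattern, used for both phase operations of the amplification. -/
theorem pullback_mul_diagonal_mul_pullback {f : Bits Q → Bits Q} (hf : Function.Involutive f)
    (d : Bits Q → ℂ) :
    pullback f * (Matrix.diagonal d * pullback f) = Matrix.diagonal (fun z => d (f z)) := by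
  refine Matrix.ext_of_mulVec_single fun w => ?_
  funext z
  rw [← Matrix.mulVec_mulVec, ← Matrix.mulVec_mulVec, pullback_mulVec, Matrix.mulVec_diagonal,
    Matrix.mulVec_diagonal, pullback_mulVec, hf]

theorem cnot_mulVec {p q : Q} (h : p ≠ q) (ψ : Bits Q → ℂ) (z : Bits Q) :
    (onWires (wirePair h) (controlled pauliX) *ᵥ ψ) z =
      ψ (if z p then Function.update z q (!z q) else z) := by
  rw [onWires_wirePair_mulVec]
  split_ifs
  · cases hz : z q <;> simp [pauliX]
  · rfl

theorem sqrtX_twice {Q : Type} [DecidableEq Q] (ψ : Bits Q → ℂ) (q : Q) (z : Bits Q) :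
    ∑ b, sqrtX (z q) b * ∑ c, sqrtX b c * ψ (Function.update z q c) =
      ψ (Function.update z q (!z q)) := by
  simp only [Fintype.sum_bool]
  cases z q <;> simp only [sqrtX, Matrix.of_apply] <;> simp <;> ring_nf <;> simp <;> ring

/-- The action on basis states of the gate which flips `t` if `p` or `q` is `1`. -/
def orFlip {Q : Type} [DecidableEq Q] (p q t : Q) (z : Bits Q) : Bits Q :=
  if z p || z q then Function.update z t (!z t) else z

theorem orFlip_involutive {Q : Type} [DecidableEq Q] {p q t : Q} (hp : p ≠ t) (hq : q ≠ t) :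
    Function.Involutive (orFlip p q t) := by
  intro z
  by_cases h : (z p || z q) = true
  · have : orFlip p q t z = Function.update z t (!z t) := if_pos h
    rw [this, orFlip, Function.update_of_ne hp, Function.update_of_ne hq, if_pos h]
    simp
  · have : orFlip p q t z = z := if_neg h
    rw [this, this]

/-- Five gates on two qubits realize the operation that flips `t` if `p` or `q` is `1`. -/
theorem or_decomposition {p q t : Q} (hpq : p ≠ q) (hp : p ≠ t) (hq : q ≠ t) :
    onWires (wirePair hp) (controlled sqrtX) * (onWires (wirePair hq) (controlled sqrtX) *
      (onWires (wirePair hpq) (controlled pauliX) * (onWires (wirePair hq) (controlled sqrtX) *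
      onWires (wirePair hpq) (controlled pauliX)))) = pullback (orFlip p q t) := by
  -- The target receives one square root of `X` for each of `p`, `q` and `p ⊕ q` that is `1`. Since
  -- `p + q + (p ⊕ q) = 2 (p ∨ q)`, the total is `X` or the identity, and no inverse root is needed.
  refine eq_pullback fun ψ z => ?_
  simp only [← Matrix.mulVec_mulVec]
  have h1 := sqrtX_twice ψ t z
  have hc : ∀ (b b' : Bool), Function.update (Function.update z t b) q b' =
    Function.update (Function.update z q b') t b := fun b b' => Function.update_comm hq.symm _ _ _
  simp only [onWires_wirePair_mulVec hp, onWires_wirePair_mulVec hq, cnot_mulVec]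
  simp only [Fintype.sum_bool] at h1 ⊢
  cases h2 : z p <;> cases h3 : z q
  all_goals
    have h4 : Function.update z q (z q) = z := Function.update_eq_self _ _
    have h5 : ∀ b b', Function.update (Function.update (Function.update z q b') t b) q (z q) =
        Function.update z t b := fun b b' => by
      rw [Function.update_comm hq.symm, Function.update_idem, h4]
    rw [h3] at h4 h5
    simp [orFlip, h2, h3, h5, hc, Function.update_of_ne hp, Function.update_of_ne hq,
      Function.update_of_ne hpq, Function.update_of_ne hq.symm, h1]

end Gates

/-! ### Circuits: their operators, inverses and gate counts. -/

section Circuits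

variable {n m N : ℕ}

/-- The action on basis states of an equivalence query. -/
def eqMap (a : Bits (Fin n)) (z : Bits (Fin n ⊕ Fin 1)) : Bits (Fin n ⊕ Fin 1) :=
  Sum.elim (fun i => z (Sum.inl i))
    (fun j => if (fun i => z (Sum.inl i)) = a then !z (Sum.inr j) else z (Sum.inr j))

theorem eqMap_involutive (a : Bits (Fin n)) : Function.Involutive (eqMap a) := by
  intro z
  funext q
  rcases q with i | j
  · rfl
  · by_cases h : (fun i => z (Sum.inl i)) = a <;> simp [eqMap, h]

/-- The query moves basis states forward while a pullback moves them backward; the two agree because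
the map is an involution. -/
theorem eqQuery_eq_pullback (a : Bits (Fin n)) : eqQuery a = pullback (eqMap a) := by
  ext z' z
  exact if_congr ⟨fun h => ((eqMap_involutive a).eq_iff.1 h.symm),
    fun h => ((eqMap_involutive a).eq_iff.1 h.symm)⟩ rfl rfl

theorem eqQuery_conjTranspose (a : Bits (Fin n)) : (eqQuery a)ᴴ = eqQuery a := by
  conv_rhs => rw [eqQuery_eq_pullback]
  ext z' z
  simp only [eqQuery, pullback, eqMap, Matrix.conjTranspose_apply, Matrix.of_apply,
    apply_ite star, star_one, star_zero]
  exact if_congr Iff.rfl rfl rfl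

theorem onWires_pullback {ι Q : Type} [Fintype ι] [DecidableEq ι] [Fintype Q] [DecidableEq Q]
    (e : ι ↪ Q) (f : Bits ι → Bits ι) :
    onWires e (pullback f) = pullback fun z => Function.extend e (f fun i => z (e i)) z := by
  refine eq_pullback fun ψ z => ?_
  rw [onWires_mulVec]
  simp [pullback]

theorem eqQuery_mem_unitaryGroup (a : Bits (Fin n)) :
    eqQuery a ∈ Matrix.unitaryGroup (Bits (Fin n ⊕ Fin 1)) ℂ := by
  rw [Matrix.mem_unitaryGroup_iff, Matrix.star_eq_conjTranspose, eqQuery_conjTranspose,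
    eqQuery_eq_pullback]
  refine Matrix.ext_of_mulVec_single fun w => ?_
  funext z
  rw [← Matrix.mulVec_mulVec, pullback_mulVec, pullback_mulVec, Matrix.one_mulVec]
  rw [eqMap_involutive]

/-- The action on basis states of an equivalence query on the qubits selected by `e`. -/
def eqFlip (a : Bits (Fin n)) (e : Fin n ⊕ Fin 1 ↪ Fin N) (z : Bits (Fin N)) : Bits (Fin N) :=
  if (fun i => z (e (Sum.inl i))) = a then
    Function.update z (e (Sum.inr 0)) (!z (e (Sum.inr 0))) else z

theorem eqFlip_involutive (a : Bits (Fin n)) (e : Fin n ⊕ Fin 1 ↪ Fin N) :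
    Function.Involutive (eqFlip a e) := by
  intro z
  by_cases h : (fun i => z (e (Sum.inl i))) = a
  · have h1 : eqFlip a e z = Function.update z (e (Sum.inr 0)) (!z (e (Sum.inr 0))) := if_pos h
    rw [h1, eqFlip, if_pos]
    · simp
    · rw [← h]
      funext i
      exact Function.update_of_ne (by simp) _ _
  · have h1 : eqFlip a e z = z := if_neg h
    rw [h1, h1]

theorem onWires_eqQuery (a : Bits (Fin n)) (e : Fin n ⊕ Fin 1 ↪ Fin N) :
    onWires e (eqQuery a) = pullback (eqFlip a e) := by
  rw [eqQuery_eq_pullback, onWires_pullback]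
  congr 1
  funext z q
  by_cases hq : ∃ i, e i = q
  · obtain ⟨i | j, rfl⟩ := hq
    · rw [e.injective.extend_apply, eqFlip]
      split_ifs
      · rw [Function.update_of_ne (by simp)]
        rfl
      · rfl
    · rw [e.injective.extend_apply, eqFlip, Subsingleton.elim j 0]
      split_ifs with h <;> simp [eqMap, h]
  · rw [Function.extend_apply' _ _ _ hq, eqFlip]
    split_ifs
    · rw [Function.update_of_ne]
      exact fun h => hq ⟨_, h.symm⟩
    · rfl

namespace Step

/-- The inverse of a step. -/
def inv : Step n m N → Step n m N
  | gate k hk V e => gate k hk V⁻¹ e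
  | ip e => ipInv e
  | ipInv e => ip e
  | eq e => eq e

theorem op_inv (U : QOp (Fin n ⊕ Fin m)) (a : Bits (Fin n)) (s : Step n m N) :
    s.inv.op U a = (s.op U a)ᴴ := by
  cases s with
  | gate k hk V e => exact onWires_conjTranspose e V.1
  | ip e => exact onWires_conjTranspose e U
  | ipInv e =>
    change onWires e U = (onWires e Uᴴ)ᴴ
    rw [← onWires_conjTranspose, Matrix.conjTranspose_conjTranspose]
  | eq e =>
    change onWires e (eqQuery a) = (onWires e (eqQuery a))ᴴ
    rw [← onWires_conjTranspose, eqQuery_conjTranspose]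

theorem isQuery_inv (s : Step n m N) : s.inv.isQuery = s.isQuery := by
  cases s <;> rfl

theorem op_mem_unitaryGroup {U : QOp (Fin n ⊕ Fin m)}
    (hU : U ∈ Matrix.unitaryGroup (Bits (Fin n ⊕ Fin m)) ℂ) (a : Bits (Fin n))
    (s : Step n m N) : s.op U a ∈ Matrix.unitaryGroup (Bits (Fin N)) ℂ := by
  cases s with
  | gate k hk V e => exact onWires_mem_unitaryGroup e V.2
  | ip e => exact onWires_mem_unitaryGroup e hU
  | ipInv e => exact onWires_mem_unitaryGroup e (Unitary.star_mem hU)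
  | eq e => exact onWires_mem_unitaryGroup e (eqQuery_mem_unitaryGroup a)

/-- A gate on the qubit `q`. -/
def single (V : Matrix.unitaryGroup Bool ℂ) (q : Fin N) : Step n m N :=
  gate 1 one_le_two ⟨oneQubit V.1, oneQubit_mem_unitaryGroup V.2⟩ (wire q)

/-- A phase gate on the qubit `q`. -/
def phase (d : Bool → Circle) (q : Fin N) : Step n m N :=
  single ⟨Matrix.diagonal fun b => (d b : ℂ),
    diagonal_mem_unitaryGroup fun b => Circle.norm_coe (d b)⟩ q

/-- The gate that applies `V` to `q` controlled by `p`. -/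
def control (V : Matrix.unitaryGroup Bool ℂ) {p q : Fin N} (h : p ≠ q) : Step n m N :=
  gate 2 le_rfl ⟨controlled V.1, controlled_mem_unitaryGroup V.2⟩ (wirePair h)

theorem op_phase (U : QOp (Fin n ⊕ Fin m)) (a : Bits (Fin n)) (d : Bool → Circle) (q : Fin N) :
    (phase d q : Step n m N).op U a = Matrix.diagonal fun z => (d (z q) : ℂ) :=
  onWires_wire_diagonal q fun b => (d b : ℂ)

end Step

/-- The operator performed by a list of steps, the first one at the head. -/
def circuitOp (U : QOp (Fin n ⊕ Fin m)) (a : Bits (Fin n)) : List (Step n m N) → QOp (Fin N)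
  | [] => 1
  | s :: l => circuitOp U a l * s.op U a

/-- The circuit that undoes `l`. -/
def invCircuit (l : List (Step n m N)) : List (Step n m N) := (l.map Step.inv).reverse

section

variable (U : QOp (Fin n ⊕ Fin m)) (a : Bits (Fin n))

theorem circuitOp_append (l l' : List (Step n m N)) :
    circuitOp U a (l ++ l') = circuitOp U a l' * circuitOp U a l := by
  induction l with
  | nil => simp [circuitOp]
  | cons s l ih => simp [circuitOp, ih, Matrix.mul_assoc]

theorem circuitOp_invCircuit (l : List (Step n m N)) :
    circuitOp U a (invCircuit l) = (circuitOp U a l)ᴴ := by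
  induction l with
  | nil => simp [circuitOp, invCircuit]
  | cons s l ih =>
    have h : invCircuit (s :: l) = invCircuit l ++ [s.inv] := by simp [invCircuit]
    rw [h, circuitOp_append, ih]
    simp [circuitOp, Step.op_inv]

theorem circuitOp_mem_unitaryGroup (hU : U ∈ Matrix.unitaryGroup (Bits (Fin n ⊕ Fin m)) ℂ)
    (l : List (Step n m N)) : circuitOp U a l ∈ Matrix.unitaryGroup (Bits (Fin N)) ℂ := by
  induction l with
  | nil => exact one_mem _
  | cons s l ih => exact mul_mem ih (s.op_mem_unitaryGroup hU a)

theorem foldl_op_mulVec (l : List (Step n m N)) (ψ : Bits (Fin N) → ℂ) :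
    l.foldl (fun ψ s => s.op U a *ᵥ ψ) ψ = circuitOp U a l *ᵥ ψ := by
  induction l generalizing ψ with
  | nil => simp [circuitOp]
  | cons s l ih => simp [circuitOp, ih, Matrix.mulVec_mulVec]

end

/-- The number of queries in a circuit. -/
def numQueries (l : List (Step n m N)) : ℕ := l.countP fun s => s.isQuery

/-- The number of gates in a circuit. -/
def numGates (l : List (Step n m N)) : ℕ := l.countP fun s => !s.isQuery

theorem numQueries_append (l l' : List (Step n m N)) :
    numQueries (l ++ l') = numQueries l + numQueries l' := List.countP_append

theorem numGates_append (l l' : List (Step n m N)) :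
    numGates (l ++ l') = numGates l + numGates l' := List.countP_append

theorem numQueries_invCircuit (l : List (Step n m N)) :
    numQueries (invCircuit l) = numQueries l := by
  simp [numQueries, invCircuit, List.countP_reverse, List.countP_map, Function.comp_def,
    Step.isQuery_inv]

theorem numGates_invCircuit (l : List (Step n m N)) :
    numGates (invCircuit l) = numGates l := by
  simp [numGates, invCircuit, List.countP_reverse, List.countP_map, Function.comp_def,
    Step.isQuery_inv]

end Circuits

/-! ### The phase on the all-zero state. -/

section Reflections

variable {n m N : ℕ}

/-- Gates that flip `t` if `p` or `q` is `1`. -/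
noncomputable def orGate (p q t : Fin N) : List (Step n m N) :=
  if h : p ≠ q ∧ p ≠ t ∧ q ≠ t then
    [.control ⟨pauliX, pauliX_mem_unitaryGroup⟩ h.1,
      .control ⟨sqrtX, sqrtX_mem_unitaryGroup⟩ h.2.2,
      .control ⟨pauliX, pauliX_mem_unitaryGroup⟩ h.1,
      .control ⟨sqrtX, sqrtX_mem_unitaryGroup⟩ h.2.2,
      .control ⟨sqrtX, sqrtX_mem_unitaryGroup⟩ h.2.1]
  else []

theorem circuitOp_orGate (U : QOp (Fin n ⊕ Fin m)) (a : Bits (Fin n)) {p q t : Fin N}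
    (hpq : p ≠ q) (hp : p ≠ t) (hq : q ≠ t) :
    circuitOp U a (orGate p q t) = pullback (orFlip p q t) := by
  rw [← or_decomposition hpq hp hq, orGate, dif_pos ⟨hpq, hp, hq⟩]
  simp only [circuitOp, Matrix.one_mul, Matrix.mul_assoc]
  rfl

theorem numQueries_orGate (p q t : Fin N) : numQueries (orGate p q t : List (Step n m N)) = 0 := by
  unfold orGate
  split_ifs <;> rfl

theorem numGates_orGate (p q t : Fin N) : numGates (orGate p q t : List (Step n m N)) ≤ 5 := by
  unfold orGate
  split_ifs
  · exact le_rfl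
  · exact Nat.zero_le _

/-- The phase factors that are `ω b` on the value `b` and trivial on the other value. -/
noncomputable def phaseAt (b : Bool) (ω : Circle) (c : Bool) : Circle := if c = b then ω else 1

variable {R : Type} (E : R ⊕ Option R ↪ Fin N) (ω : Circle)

/-- A circuit that applies the phase `ω` if the auxiliary qubit `c` and the data qubits in the list
all are `0`: their disjunction is computed by a ladder of auxiliary qubits. -/
noncomputable def zeroPhase : Option R → List R → List (Step n m N)
  | c, [] => [.phase (phaseAt false ω) (E (Sum.inr c))]
  | c, i :: l =>
    orGate (E (Sum.inr c)) (E (Sum.inl i)) (E (Sum.inr (some i))) ++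
      (zeroPhase (some i) l ++
        orGate (E (Sum.inr c)) (E (Sum.inl i)) (E (Sum.inr (some i))))

/-- The phase factors applied by `zeroPhase`. -/
noncomputable def zeroPhaseValue : Option R → List R → Bits (Fin N) → Circle
  | c, [], z => phaseAt false ω (z (E (Sum.inr c)))
  | c, i :: l, z => zeroPhaseValue (some i) l
      (orFlip (E (Sum.inr c)) (E (Sum.inl i)) (E (Sum.inr (some i))) z)

theorem numQueries_zeroPhase (c : Option R) (l : List R) :
    numQueries (zeroPhase E ω c l : List (Step n m N)) = 0 := by
  induction l generalizing c with
  | nil => rfl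
  | cons i l ih => simp [zeroPhase, numQueries_append, ih, numQueries_orGate]

theorem numGates_zeroPhase (c : Option R) (l : List R) :
    numGates (zeroPhase E ω c l : List (Step n m N)) ≤ 1 + 10 * l.length := by
  induction l generalizing c with
  | nil => exact le_rfl
  | cons i l ih =>
    have h1 := numGates_orGate (n := n) (m := m) (E (Sum.inr c)) (E (Sum.inl i))
      (E (Sum.inr (some i)))
    have h2 := ih (some i)
    simp only [zeroPhase, numGates_append, List.length_cons]
    omega

theorem circuitOp_zeroPhase (U : QOp (Fin n ⊕ Fin m)) (a : Bits (Fin n)) (c : Option R)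
    (l : List R) (h : (c :: l.map some).Nodup) :
    circuitOp U a (zeroPhase E ω c l) =
      Matrix.diagonal fun z => (zeroPhaseValue E ω c l z : ℂ) := by
  induction l generalizing c with
  | nil =>
    simp only [zeroPhase, circuitOp, Matrix.one_mul, Step.op_phase]
    rfl
  | cons i l ih =>
    have hc : c ≠ some i := fun hc => by simp [hc] at h
    have hp : E (Sum.inr c) ≠ E (Sum.inr (some i)) := by simpa using hc
    have hq : E (Sum.inl i) ≠ E (Sum.inr (some i)) := by simp
    rw [zeroPhase, circuitOp_append, circuitOp_append, circuitOp_orGate U a (by simp) hp hq,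
      ih (some i) (List.nodup_cons.1 h).2, Matrix.mul_assoc,
      pullback_mul_diagonal_mul_pullback (orFlip_involutive hp hq)]
    rfl

/-- Induction along the ladder: `c` holds the disjunction of the qubits already read, and the
auxiliary qubits of the remaining list must still be `0` for a flip to write the next disjunction.
-/
theorem zeroPhaseValue_eq (c : Option R) (l : List R) (h : (c :: l.map some).Nodup)
    (z : Bits (Fin N)) (hz : ∀ j ∈ l, z (E (Sum.inr (some j))) = false) :
    zeroPhaseValue E ω c l z =
      phaseAt true ω (!z (E (Sum.inr c)) && l.all fun i => !z (E (Sum.inl i))) := by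
  induction l generalizing c z with
  | nil => cases hc : z (E (Sum.inr c)) <;> simp [zeroPhaseValue, phaseAt, hc]
  | cons i l ih =>
    have h2 := (List.nodup_cons.1 h).2
    have hi : i ∉ l := by simpa using (List.nodup_cons.1 h2).1
    have h3 : ∀ q, q ≠ E (Sum.inr (some i)) →
        orFlip (E (Sum.inr c)) (E (Sum.inl i)) (E (Sum.inr (some i))) z q = z q := by
      intro q hq
      unfold orFlip
      split_ifs
      · exact Function.update_of_ne hq _ _
      · rfl
    have h4 : orFlip (E (Sum.inr c)) (E (Sum.inl i)) (E (Sum.inr (some i))) z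
        (E (Sum.inr (some i))) = (z (E (Sum.inr c)) || z (E (Sum.inl i))) := by
      have h5 := hz i (by simp)
      unfold orFlip
      split_ifs with h6
      · rw [Function.update_self, h5, h6]
        rfl
      · rw [h5]
        simpa using h6
    rw [zeroPhaseValue, ih (some i) h2, h4]
    · rw [List.all_cons, Bool.not_or, Bool.and_assoc]
      congr 3
      simp_rw [h3 _ (E.injective.ne Sum.inl_ne_inr)]
    · intro j hj
      rw [h3 _ (E.injective.ne _)]
      · exact hz j (by simp [hj])
      · rintro h
        rw [Sum.inr.injEq, Option.some.injEq] at h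
        exact hi (h ▸ hj)

end Reflections

/-! ### Tensor products of one-qubit operators. -/

section ProductOperators

variable {Q : Type} [Fintype Q] [DecidableEq Q]

/-- The tensor product of operators on single qubits. -/
def prodOp (A : Q → Matrix Bool Bool ℂ) : QOp Q := Matrix.of fun z' z => ∏ q, A q (z' q) (z q)

theorem prodOp_mul (A B : Q → Matrix Bool Bool ℂ) :
    prodOp A * prodOp B = prodOp fun q => A q * B q := by
  ext z' z
  simp only [prodOp, Matrix.mul_apply, Matrix.of_apply, ← Finset.prod_mul_distrib]
  rw [Finset.prod_univ_sum, Fintype.piFinset_univ]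

theorem prodOp_one : prodOp (fun _ : Q => 1) = 1 := by
  ext z' z
  simp only [prodOp, Matrix.of_apply, Matrix.one_apply, Finset.prod_ite_zero, Finset.prod_const_one]
  exact if_congr (by simp [funext_iff]) rfl rfl

theorem onWires_wire_eq_prodOp (q : Q) (A : Matrix Bool Bool ℂ) :
    onWires (wire q) (oneQubit A) = prodOp fun r => if r = q then A else 1 := by
  ext z' z
  simp only [onWires, prodOp, Matrix.of_apply]
  by_cases h : ∀ r, r ≠ q → z' r = z r
  · rw [if_pos fun r hr => h r fun h' => hr 0 h'.symm, Finset.prod_eq_single q]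
    · rw [if_pos rfl]
      rfl
    · intro r _ hr
      rw [if_neg hr, h r hr, Matrix.one_apply_eq]
    · simp
  · rw [if_neg fun h' => h fun r hr => h' r fun _ => hr.symm]
    push Not at h
    obtain ⟨r, hr, hz⟩ := h
    refine (Finset.prod_eq_zero (Finset.mem_univ r) ?_).symm
    rw [if_neg hr, Matrix.one_apply_ne hz]

end ProductOperators

/-! ### The quantum Goldreich-Levin circuit and its amplitude at the hidden string. -/

section BaseCircuit

variable {n m N : ℕ}

/-- The sign `(-1) ^ b`. -/
def bitSign (b : Bool) : ℂ := if b then -1 else 1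

theorem prod_hadamard (a x : Bits (Fin n)) :
    ∏ i, hadamard (a i) (x i) = (Real.sqrt 2 : ℂ)⁻¹ ^ n * bitSign (bitInner a x) := by
  simp only [hadamard, Matrix.of_apply, Finset.prod_mul_distrib, Finset.prod_const,
    Finset.card_univ, Fintype.card_fin]
  congr 1
  rw [Finset.prod_ite, Finset.prod_const, Finset.prod_const_one, mul_one, bitSign, bitInner]
  simp only [Bool.and_eq_true, decide_eq_true_eq]
  split_ifs with h
  · exact h.neg_one_pow
  · exact (Nat.not_odd_iff_even.1 h).neg_one_pow

/-- Hadamard gates on the first `n` qubits of the input register of an inner product query. -/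
noncomputable def hadamardOp : QOp (Fin n ⊕ Fin m) :=
  prodOp (Sum.elim (fun _ => hadamard) fun _ => 1)

theorem hadamardOp_apply (x' x : Bits (Fin n)) (y' y : Bits (Fin m)) :
    hadamardOp (Sum.elim x' y') (Sum.elim x y) =
      if y' = y then (Real.sqrt 2 : ℂ)⁻¹ ^ n * bitSign (bitInner x' x) else 0 := by
  simp only [hadamardOp, prodOp, Matrix.of_apply, Fintype.prod_sum_type, Sum.elim_inl,
    Sum.elim_inr, prod_hadamard, Matrix.one_apply, Finset.prod_ite_zero, Finset.prod_const_one,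
    mul_ite, mul_one, mul_zero]
  exact if_congr (by simp [funext_iff]) rfl rfl

theorem hadamardOp_conjTranspose : (hadamardOp : QOp (Fin n ⊕ Fin m))ᴴ = hadamardOp := by
  have h1 : ∀ b c, star (hadamard b c) = hadamard c b := by
    intro b c
    cases b <;> cases c <;> simp [hadamard]
  have h2 : ∀ b c : Bool, star ((1 : Matrix Bool Bool ℂ) b c) = (1 : Matrix Bool Bool ℂ) c b := by
    intro b c
    cases b <;> cases c <;> simp
  ext z' z
  simp only [hadamardOp, prodOp, Matrix.conjTranspose_apply, Matrix.of_apply,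
    Fintype.prod_sum_type, Sum.elim_inl, Sum.elim_inr, star_mul', star_prod, h1, h2]

theorem sum_bits_sum {β : Type} [AddCommMonoid β] (f : Bits (Fin n ⊕ Fin m) → β) :
    ∑ z, f z = ∑ x, ∑ y, f (Sum.elim x y) := by
  rw [← Fintype.sum_prod_type' (f := fun x y => f (Sum.elim x y))]
  refine Fintype.sum_equiv (Equiv.sumArrowEquivProdArrow _ _ _) _ _ fun z => ?_
  congr 1
  funext q
  rcases q with i | j <;> rfl

/-- As `U` preserves the first `n` qubits, only the `x` read off from `w` contributes to the sum
over intermediate states. -/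
theorem mul_hadamardOp_apply {U : QOp (Fin n ⊕ Fin m)}
    (hU : ∀ (x : Bits (Fin n)) (y : Bits (Fin m)) (z : Bits (Fin n ⊕ Fin m)),
      (fun i => z (Sum.inl i)) ≠ x → U z (Sum.elim x y) = 0)
    (b : Bits (Fin n)) (w : Bits (Fin n ⊕ Fin m)) :
    (U * hadamardOp : QOp (Fin n ⊕ Fin m)) w (Sum.elim b fun _ => false) =
      (Real.sqrt 2 : ℂ)⁻¹ ^ n * bitSign (bitInner (fun i => w (Sum.inl i)) b) *
        U w (Sum.elim (fun i => w (Sum.inl i)) fun _ => false) := by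
  rw [Matrix.mul_apply, sum_bits_sum, Finset.sum_eq_single fun i => w (Sum.inl i)]
  · simp only [hadamardOp_apply, mul_ite, mul_zero, Finset.sum_ite_eq', Finset.mem_univ, if_true]
    ring
  · intro x _ hx
    exact Finset.sum_eq_zero fun y _ => by rw [hU x y w hx.symm, zero_mul]
  · simp

theorem bitInner_comm (a x : Bits (Fin n)) : bitInner a x = bitInner x a := by
  simp only [bitInner, and_comm]

theorem bitInner_zero (x : Bits (Fin n)) : bitInner x (fun _ => false) = false := by
  simp [bitInner]

/-- The last qubit of the register of an inner product query. -/
def lastQubit (hm : 0 < m) : Fin n ⊕ Fin m := Sum.inr ⟨m - 1, Nat.sub_one_lt_of_lt hm⟩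

/-- The operator of the quantum Goldreich-Levin algorithm. -/
noncomputable def baseOp (hm : 0 < m) (U : QOp (Fin n ⊕ Fin m)) : QOp (Fin n ⊕ Fin m) :=
  hadamardOp * (Uᴴ * (Matrix.diagonal (fun z => bitSign (z (lastQubit hm))) * (U * hadamardOp)))

/-- The amplitude of the hidden string after the quantum Goldreich-Levin algorithm. -/
theorem baseOp_apply {hm : 0 < m} {ε : ℝ} {a : Bits (Fin n)} {U : QOp (Fin n ⊕ Fin m)}
    (h : IsIPQuery hm ε a U) :
    ∃ α : ℝ, 2 * ε ≤ α ∧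
      baseOp hm U (Sum.elim a fun _ => false) (fun _ => false) = α := by
  set P : Bits (Fin n ⊕ Fin m) → ℝ := fun w =>
    ‖U w (Sum.elim (fun i => w (Sum.inl i)) fun _ => false)‖ ^ 2 with hP
  set good : Bits (Fin n ⊕ Fin m) → Prop := fun w =>
    w (lastQubit hm) = bitInner a (fun i => w (Sum.inl i)) with hgood
  -- A sum over inputs `x` and outcomes `w` collapses to one over `w`, because `w` determines `x`.
  have hctl : ∀ (f : Bits (Fin n) → Bits (Fin n ⊕ Fin m) → Prop) [∀ x w, Decidable (f x w)],
      ∑ x, ∑ w ∈ Finset.univ.filter (f x), ‖U w (Sum.elim x fun _ => false)‖ ^ 2 =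
        ∑ w, if f (fun i => w (Sum.inl i)) w then P w else 0 := by
    intro f _
    simp only [Finset.sum_filter]
    rw [Finset.sum_comm]
    refine Finset.sum_congr rfl fun w _ => ?_
    rw [Finset.sum_eq_single fun i => w (Sum.inl i)]
    · intro x _ hx
      rw [h.control x _ w hx.symm]
      simp
    · simp
  have hbias := h.bias
  rw [hctl fun x w => w (Sum.inr ⟨m - 1, Nat.sub_one_lt_of_lt hm⟩) = bitInner a x] at hbias
  have htot : ∑ w, P w = 2 ^ n := by
    have h1 := hctl fun _ _ => True
    simp only [Finset.filter_true, if_true] at h1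
    rw [← h1]
    have h2 : ∀ z, ∑ w, ‖U w z‖ ^ 2 = 1 := by
      intro z
      have h3 := congrFun (congrFun (Matrix.mem_unitaryGroup_iff'.1 h.unitary) z) z
      rw [Matrix.mul_apply, Matrix.one_apply_eq] at h3
      simp only [Matrix.star_apply, RCLike.star_def, Complex.conj_mul'] at h3
      exact_mod_cast h3
    simp [h2]
  have hentry : baseOp hm U (Sum.elim a fun _ => false) (fun _ => false) =
      ((1 / 2 ^ n * ∑ w, (if good w then P w else -P w) : ℝ) : ℂ) := by
    have h0 : (fun _ => false : Bits (Fin n ⊕ Fin m)) =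
        Sum.elim (fun _ => false) fun _ => false := by
      funext q
      rcases q with i | j <;> rfl
    -- The entry becomes an inner product of two columns of `U * hadamardOp`. The Hadamard sign
    -- `(-1)^(a·x)` times the sign of the last qubit is `1` exactly on correct outcomes.
    have h1 : baseOp hm U = (U * hadamardOp)ᴴ *
        (Matrix.diagonal (fun z => bitSign (z (lastQubit hm))) * (U * hadamardOp)) := by
      rw [Matrix.conjTranspose_mul, hadamardOp_conjTranspose, Matrix.mul_assoc]
      rfl
    have h2 : (starRingEnd ℂ) (Real.sqrt 2 : ℂ)⁻¹ ^ n * (Real.sqrt 2 : ℂ)⁻¹ ^ n = 1 / 2 ^ n := by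
      rw [map_inv₀, Complex.conj_ofReal, ← mul_pow, ← mul_inv, ← Complex.ofReal_mul,
        Real.mul_self_sqrt (by norm_num)]
      simp
    rw [h1, h0, Matrix.mul_apply, Complex.ofReal_mul, Complex.ofReal_sum, Finset.mul_sum]
    refine Finset.sum_congr rfl fun w _ => ?_
    rw [Matrix.diagonal_mul, Matrix.conjTranspose_apply, mul_hadamardOp_apply h.control,
      mul_hadamardOp_apply h.control, bitInner_zero, RCLike.star_def, map_mul, map_mul, map_pow]
    have h3 : (starRingEnd ℂ) (bitSign (bitInner (fun i => w (Sum.inl i)) a)) *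
        bitSign (w (lastQubit hm)) = if good w then 1 else -1 := by
      simp only [hgood, bitInner_comm a]
      cases bitInner (fun i => w (Sum.inl i)) a <;> cases w (lastQubit hm) <;> simp [bitSign]
    have h4 : (starRingEnd ℂ) (U w (Sum.elim (fun i => w (Sum.inl i)) fun _ => false)) *
        U w (Sum.elim (fun i => w (Sum.inl i)) fun _ => false) = (P w : ℂ) := by
      rw [Complex.conj_mul', hP]
      simp
    have h5 : (((if good w then P w else -P w) : ℝ) : ℂ) =
        (if good w then 1 else -1) * (P w : ℂ) := by
      split_ifs <;> simp
    rw [h5, ← h3, ← h4]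
    have h6 : (((1 / 2 ^ n : ℝ)) : ℂ) = 1 / 2 ^ n := by simp
    rw [h6, ← h2]
    simp only [bitSign, Bool.false_eq_true, if_false]
    ring
  refine ⟨_, ?_, hentry⟩
  have h7 : ∑ w, (if good w then P w else -P w) =
      2 * (∑ w, if good w then P w else 0) - 2 ^ n := by
    rw [← htot, Finset.mul_sum, ← Finset.sum_sub_distrib]
    refine Finset.sum_congr rfl fun w _ => ?_
    split_ifs <;> ring
  have h8 : (1 / 2 ^ n : ℝ) * 2 ^ n = 1 := by field_simp
  rw [h7, mul_sub, h8]
  have h9 : 1 / 2 + ε ≤ 1 / 2 ^ n * ∑ w, if good w then P w else 0 := hbias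
  linarith

/-- Hadamard gates on the first `n` qubits selected by `e`. -/
noncomputable def hadamardLayer (e : Fin n ⊕ Fin m ↪ Fin N) : List (Step n m N) :=
  (List.finRange n).map fun i =>
    .single ⟨hadamard, hadamard_mem_unitaryGroup⟩ (e (Sum.inl i))

/-- The circuit of the quantum Goldreich-Levin algorithm. -/
noncomputable def baseCircuit (hm : 0 < m) (e : Fin n ⊕ Fin m ↪ Fin N) : List (Step n m N) :=
  hadamardLayer e ++ (.ip e :: .phase (fun b => if b then -1 else 1) (e (lastQubit hm)) ::
    .ipInv e :: hadamardLayer e)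

/-- Stated for partial lists to permit induction. Repetitions are excluded since two Hadamards on
one qubit would cancel. -/
theorem circuitOp_map_hadamard (U : QOp (Fin n ⊕ Fin m)) (a : Bits (Fin n))
    (e : Fin n ⊕ Fin m ↪ Fin N) (l : List (Fin n)) (hl : l.Nodup) :
    circuitOp U a (l.map fun i =>
        .single ⟨hadamard, hadamard_mem_unitaryGroup⟩ (e (Sum.inl i))) =
      onWires e (prodOp (Sum.elim (fun i => if i ∈ l then hadamard else 1) fun _ => 1)) := by
  induction l with
  | nil =>
    have : (Sum.elim (fun i => if i ∈ [] then hadamard else 1) fun _ => 1 :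
        Fin n ⊕ Fin m → Matrix Bool Bool ℂ) = fun _ => 1 := by
      funext q
      rcases q with i | j <;> simp
    rw [this, prodOp_one, onWires_one]
    rfl
  | cons i l ih =>
    have h1 : (Step.single ⟨hadamard, hadamard_mem_unitaryGroup⟩ (e (Sum.inl i)) :
        Step n m N).op U a = onWires e (onWires (wire (Sum.inl i)) (oneQubit hadamard)) := by
      rw [← onWires_trans]
      rfl
    rw [List.map_cons, circuitOp, ih (List.nodup_cons.1 hl).2, h1, ← onWires_mul,
      onWires_wire_eq_prodOp, prodOp_mul]
    congr 2
    funext q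
    rcases q with j | j
    · by_cases hj : j = i
      · subst hj
        simp [(List.nodup_cons.1 hl).1]
      · simp [hj]
    · simp

theorem circuitOp_hadamardLayer (U : QOp (Fin n ⊕ Fin m)) (a : Bits (Fin n))
    (e : Fin n ⊕ Fin m ↪ Fin N) : circuitOp U a (hadamardLayer e) = onWires e hadamardOp := by
  rw [hadamardLayer, circuitOp_map_hadamard U a e _ (List.nodup_finRange n)]
  simp [hadamardOp]

theorem circuitOp_baseCircuit (hm : 0 < m) (U : QOp (Fin n ⊕ Fin m)) (a : Bits (Fin n))
    (e : Fin n ⊕ Fin m ↪ Fin N) :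
    circuitOp U a (baseCircuit hm e) = onWires e (baseOp hm U) := by
  have h1 : (Step.phase (fun b => if b then -1 else 1) (e (lastQubit hm)) : Step n m N).op U a =
      onWires e (Matrix.diagonal fun z => bitSign (z (lastQubit hm))) := by
    have h2 : (Matrix.diagonal fun z : Bits (Fin n ⊕ Fin m) => bitSign (z (lastQubit hm))) =
        onWires (wire (lastQubit hm)) (oneQubit (Matrix.diagonal bitSign)) := by
      rw [onWires_wire_diagonal]
    rw [h2, ← onWires_trans, Step.op_phase]
    have h3 : (wire (lastQubit hm)).trans e = wire (e (lastQubit hm)) := rfl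
    rw [h3, onWires_wire_diagonal]
    congr 1
    funext z
    cases z (e (lastQubit hm)) <;> simp [bitSign]
  rw [baseCircuit, circuitOp_append]
  simp only [circuitOp, h1, circuitOp_hadamardLayer, baseOp, onWires_mul, Matrix.mul_assoc]
  rfl

theorem numQueries_hadamardLayer (e : Fin n ⊕ Fin m ↪ Fin N) :
    numQueries (hadamardLayer e) = 0 := by
  rw [numQueries, List.countP_eq_zero]
  intro s hs
  obtain ⟨i, _, rfl⟩ := List.mem_map.1 hs
  exact Bool.false_ne_true

theorem numGates_hadamardLayer (e : Fin n ⊕ Fin m ↪ Fin N) : numGates (hadamardLayer e) ≤ n := by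
  refine List.countP_le_length.trans ?_
  simp [hadamardLayer]

theorem numQueries_baseCircuit (hm : 0 < m) (e : Fin n ⊕ Fin m ↪ Fin N) :
    numQueries (baseCircuit hm e) = 2 := by
  have h : baseCircuit hm e = hadamardLayer e ++ ([.ip e,
    .phase (fun b => if b then -1 else 1) (e (lastQubit hm)), .ipInv e] ++ hadamardLayer e) := rfl
  rw [h, numQueries_append, numQueries_append, numQueries_hadamardLayer]
  rfl

theorem numGates_baseCircuit (hm : 0 < m) (e : Fin n ⊕ Fin m ↪ Fin N) :
    numGates (baseCircuit hm e) ≤ 2 * n + 1 := by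
  have h : baseCircuit hm e = hadamardLayer e ++ ([.ip e,
    .phase (fun b => if b then -1 else 1) (e (lastQubit hm)), .ipInv e] ++ hadamardLayer e) := rfl
  have h1 := numGates_hadamardLayer e
  have h2 : numGates ([.ip e, .phase (fun b => if b then -1 else 1) (e (lastQubit hm)),
    .ipInv e] : List (Step n m N)) = 1 := rfl
  rw [h, numGates_append, numGates_append, h2]
  omega

end BaseCircuit

/-! ### One level of amplitude amplification, and the choice of its phase. -/

section Amplification

variable {Q : Type} [Fintype Q] [DecidableEq Q]

theorem sum_norm_sq_mulVec_single {V : QOp Q} (hV : V ∈ Matrix.unitaryGroup (Bits Q) ℂ)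
    (o : Bits Q) : ∑ z, ‖(V *ᵥ Pi.single o 1) z‖ ^ 2 = 1 := by
  have h := congrFun (congrFun (Matrix.mem_unitaryGroup_iff'.1 hV) o) o
  rw [Matrix.mul_apply, Matrix.one_apply_eq] at h
  simp only [Matrix.star_apply, RCLike.star_def, Complex.conj_mul'] at h
  simp only [Matrix.mulVec_single_one, Matrix.col_apply]
  exact_mod_cast h

/-- One step of amplitude amplification with equal phases: the amplitudes of bad basis states are
multiplied by a common factor. -/
theorem amplification_apply {V : QOp Q} (hV : V ∈ Matrix.unitaryGroup (Bits Q) ℂ) {T : Set Q}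
    (hT : FixesWires T V) {good : Bits Q → Prop} [DecidablePred good] {dA d0 : Bits Q → ℂ}
    {o : Bits Q} (ho : ∀ q ∈ T, o q = false) {ω : ℂ} {r : ℝ} (hω : (1 - ω) ^ 2 = -r * ω)
    (hA : ∀ z, (∀ q ∈ T, z q = false) → dA z = if good z then ω else 1)
    (h0 : ∀ z, (∀ q ∈ T, z q = false) → d0 z = if z = o then ω else 1)
    {z : Bits Q} (hz : ¬ good z) :
    ((V * (Matrix.diagonal d0 * (Vᴴ * (Matrix.diagonal dA * V)))) *ᵥ Pi.single o 1) z =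
      ω * (1 - r * (∑ w with good w, ‖(V *ᵥ Pi.single o 1) w‖ ^ 2 : ℝ)) *
        (V *ᵥ Pi.single o 1) z := by
  -- All states involved are supported where the qubits in `T` are `0`, so the diagonals need to be
  -- known only there.
  have hclean : ∀ {ψ : Bits Q → ℂ}, (∀ z, (∃ q ∈ T, z q = true) → ψ z = 0) →
      ∀ z, ψ z ≠ 0 → ∀ q ∈ T, z q = false := by
    intro ψ hψ z hz q hq
    rw [← Bool.not_eq_true]
    exact fun h => hz (hψ z ⟨q, hq, h⟩)
  have hsum := sum_norm_sq_mulVec_single hV o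
  have hVV : V * Vᴴ = 1 := Matrix.mem_unitaryGroup_iff.1 hV
  simp only [← Matrix.mulVec_mulVec]
  have hentry : ∀ w, V w o = (V *ᵥ Pi.single o 1) w := by
    simp [Matrix.col_apply]
  have hψ : ∀ z, (∃ q ∈ T, z q = true) → (V *ᵥ Pi.single o 1) z = 0 := by
    refine fun z hz => hT.mulVec_eq_zero (fun w hw => ?_) z hz
    obtain ⟨q, hq, hw⟩ := hw
    refine Pi.single_eq_of_ne (fun h => ?_) _
    rw [h, ho q hq] at hw
    exact Bool.false_ne_true hw
  set ψ := V *ᵥ Pi.single o 1 with hψdef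
  have hφ : Matrix.diagonal dA *ᵥ ψ = fun w => (if good w then ω else 1) * ψ w := by
    funext w
    rw [Matrix.mulVec_diagonal]
    by_cases hw : ψ w = 0
    · simp [hw]
    · rw [hA w (hclean hψ w hw)]
  set φ := Matrix.diagonal dA *ᵥ ψ with hφdef
  have hφ0 : ∀ z, (∃ q ∈ T, z q = true) → φ z = 0 := by
    intro z hz
    rw [hφ]
    simp [hψ z hz]
  have hχ : ∀ z, (∃ q ∈ T, z q = true) → (Vᴴ *ᵥ φ) z = 0 :=
    hT.conjTranspose.mulVec_eq_zero hφ0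
  have hχo : (Vᴴ *ᵥ φ) o = 1 - (1 - ω) * (∑ w with good w, ‖ψ w‖ ^ 2 : ℝ) := by
    have h1 : (1 : ℂ) = ((∑ w, ‖ψ w‖ ^ 2 : ℝ) : ℂ) := by rw [hsum]; simp
    nth_rewrite 1 [h1]
    rw [Finset.sum_filter, Complex.ofReal_sum, Complex.ofReal_sum, Finset.mul_sum,
      ← Finset.sum_sub_distrib]
    refine Finset.sum_congr rfl fun w _ => ?_
    have h2 : star (ψ w) * ψ w = (‖ψ w‖ ^ 2 : ℝ) := by
      rw [RCLike.star_def, Complex.conj_mul', Complex.ofReal_pow]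
    change star (V w o) * φ w = _
    rw [hentry, hφ, mul_left_comm, h2]
    split_ifs
    · push_cast
      ring
    · push_cast
      ring
  -- The phase at `o` is a rank-one correction, which `V` turns into a multiple of `ψ`.
  have hd0 : Matrix.diagonal d0 *ᵥ (Vᴴ *ᵥ φ) =
      Vᴴ *ᵥ φ - ((1 - ω) * (Vᴴ *ᵥ φ) o) • Pi.single o 1 := by
    funext w
    rw [Matrix.mulVec_diagonal, Pi.sub_apply, Pi.smul_apply, smul_eq_mul]
    by_cases hw : w = o
    · subst hw
      rw [h0 w ho, if_pos rfl, Pi.single_eq_same]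
      ring
    · rw [Pi.single_eq_of_ne hw, mul_zero, sub_zero]
      by_cases hw0 : (Vᴴ *ᵥ φ) w = 0
      · rw [hw0, mul_zero]
      · rw [h0 w (hclean hχ w hw0), if_neg hw, one_mul]
  rw [hd0, Matrix.mulVec_sub, Matrix.mulVec_mulVec, hVV, Matrix.one_mulVec, Matrix.mulVec_smul,
    ← hψdef, Pi.sub_apply, Pi.smul_apply, smul_eq_mul, hχo, hφ]
  simp only [if_neg hz, one_mul]
  -- With `P` the good probability, the factor on bad states is `1 - (1 - ω)(1 - (1 - ω)P) = ω + (1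
  -- - ω)²P`.
  linear_combination (ψ z * ((∑ w with good w, ‖ψ w‖ ^ 2 : ℝ) : ℂ)) * hω

/-- The probability of the outcomes that are not good, in the image of `o`. -/
noncomputable def failProb (good : Bits Q → Prop) [DecidablePred good] (V : QOp Q)
    (o : Bits Q) : ℝ :=
  ∑ z with ¬ good z, ‖(V *ᵥ Pi.single o 1) z‖ ^ 2

theorem failProb_nonneg (good : Bits Q → Prop) [DecidablePred good] (V : QOp Q) (o : Bits Q) :
    0 ≤ failProb good V o := Finset.sum_nonneg fun _ _ => sq_nonneg _

theorem sum_good_eq (good : Bits Q → Prop) [DecidablePred good] {V : QOp Q}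
    (hV : V ∈ Matrix.unitaryGroup (Bits Q) ℂ) (o : Bits Q) :
    ∑ z with good z, ‖(V *ᵥ Pi.single o 1) z‖ ^ 2 = 1 - failProb good V o := by
  rw [failProb, eq_sub_iff_add_eq, Finset.sum_filter_add_sum_filter_not,
    sum_norm_sq_mulVec_single hV]

theorem failProb_amplification {V : QOp Q} (hV : V ∈ Matrix.unitaryGroup (Bits Q) ℂ) {T : Set Q}
    (hT : FixesWires T V) {good : Bits Q → Prop} [DecidablePred good] {dA d0 : Bits Q → ℂ}
    {o : Bits Q} (ho : ∀ q ∈ T, o q = false) {ω : Circle} {r : ℝ}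
    (hω : (1 - (ω : ℂ)) ^ 2 = -r * ω)
    (hA : ∀ z, (∀ q ∈ T, z q = false) → dA z = if good z then (ω : ℂ) else 1)
    (h0 : ∀ z, (∀ q ∈ T, z q = false) → d0 z = if z = o then (ω : ℂ) else 1) :
    failProb good (V * (Matrix.diagonal d0 * (Vᴴ * (Matrix.diagonal dA * V)))) o =
      (1 - r * (1 - failProb good V o)) ^ 2 * failProb good V o := by
  conv_rhs => enter [2]; rw [failProb]
  rw [failProb, Finset.mul_sum]
  refine Finset.sum_congr rfl fun z hz => ?_
  rw [amplification_apply hV hT ho hω hA h0 (Finset.mem_filter.1 hz).2, sum_good_eq good hV,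
    norm_mul, norm_mul, Circle.norm_coe, one_mul, mul_pow]
  congr 1
  rw [← Complex.ofReal_mul, ← Complex.ofReal_one, ← Complex.ofReal_sub, Complex.norm_real,
    Real.norm_eq_abs, sq_abs]

/-- On the unit circle `(1 - ω)² = -|1 - ω|² ω`, so a point at distance `√r` from `1` is needed; its
real part is `1 - r/2`. -/
theorem exists_phase {r : ℝ} (h0 : 0 ≤ r) (h4 : r ≤ 4) :
    ∃ ω : Circle, (1 - (ω : ℂ)) ^ 2 = -r * ω := by
  have h : 0 ≤ r - r ^ 2 / 4 := by nlinarith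
  have hs := Real.sq_sqrt h
  refine ⟨⟨⟨1 - r / 2, Real.sqrt (r - r ^ 2 / 4)⟩, ?_⟩, ?_⟩
  · rw [Submonoid.unitSphere, ← SetLike.mem_coe]
    simp only [Submonoid.coe_set_mk, Subsemigroup.coe_set_mk, mem_sphere_zero_iff_norm]
    rw [Complex.norm_def, Complex.normSq_mk, Real.sqrt_eq_one]
    nlinarith
  · apply Complex.ext
    · simp only [pow_two] at hs
      simp [pow_two]
      linarith
    · simp [pow_two]
      ring

/-- The phase for which the step of amplitude amplification has the parameter
`4 c² / (4 c² - 3)`. -/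
theorem exists_phase_of_one_le {c : ℝ} (hc : 1 ≤ c) :
    ∃ ω : Circle, (1 - (ω : ℂ)) ^ 2 = -((4 * c ^ 2 / (4 * c ^ 2 - 3) : ℝ) : ℂ) * ω := by
  have h : 0 < 4 * c ^ 2 - 3 := by nlinarith
  refine exists_phase (by positivity) ?_
  rw [div_le_iff₀ h]
  nlinarith

/-- The choice of `r` makes the left side equal to `T₃(c√F)²` for `F ≥ 0`, and `T₃` maps `[-1, 1]`
into itself. -/
theorem amplification_bound {c F : ℝ} (hc : 1 ≤ c) (h : c ^ 2 * F ≤ 1) :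
    (4 * c ^ 3 - 3 * c) ^ 2 * ((1 - 4 * c ^ 2 / (4 * c ^ 2 - 3) * (1 - F)) ^ 2 * F) ≤ 1 := by
  have h1 : 4 * c ^ 2 - 3 ≠ 0 := by nlinarith
  have h2 : (4 * c ^ 3 - 3 * c) * (1 - 4 * c ^ 2 / (4 * c ^ 2 - 3) * (1 - F)) =
      c * (4 * (c ^ 2 * F) - 3) := by
    field_simp
    ring
  have h3 : (4 * c ^ 3 - 3 * c) ^ 2 * ((1 - 4 * c ^ 2 / (4 * c ^ 2 - 3) * (1 - F)) ^ 2 * F) =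
      (c ^ 2 * F) * (4 * (c ^ 2 * F) - 3) ^ 2 := by
    rw [← mul_assoc, ← mul_pow, h2]
    ring
  rw [h3]
  -- With `x = c²F`, `1 - x(4x - 3)² = (1 - x)(4x - 1)²`.
  nlinarith [mul_nonneg (sub_nonneg.2 h) (sq_nonneg (4 * (c ^ 2 * F) - 1))]

end Amplification

/-! ### The recursive algorithm: cost and failure probability. -/

section Algorithm

variable {n m N : ℕ} (hm : 0 < m) (E : (Fin n ⊕ Fin m) ⊕ Option (Fin n ⊕ Fin m) ↪ Fin N)

/-- The data qubits. -/
def dataQubits : Fin n ⊕ Fin m ↪ Fin N := Function.Embedding.inl.trans E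

/-- The first `n` data qubits and an auxiliary qubit. -/
def eqQubits : Fin n ⊕ Fin 1 ↪ Fin N :=
  Function.Embedding.trans
    ⟨Sum.elim (fun i => Sum.inl (Sum.inl i)) fun _ => Sum.inr none, by
      rintro (i | i) (j | j) h <;> simp_all [eq_iff_true_of_subsingleton]⟩ E

/-- A circuit that applies the phase `ω` to the hidden string. -/
noncomputable def hiddenPhase (ω : Circle) : List (Step n m N) :=
  [.eq (eqQubits E), .phase (phaseAt true ω) (E (Sum.inr none)), .eq (eqQubits E)]

/-- Amplitude amplification, applied `k` times to the quantum Goldreich-Levin algorithm. -/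
noncomputable def amplified (ω : ℕ → Circle) : ℕ → List (Step n m N)
  | 0 => baseCircuit hm (dataQubits E)
  | k + 1 => amplified ω k ++ (hiddenPhase E (ω k) ++ (invCircuit (amplified ω k) ++
      (zeroPhase E (ω k) none Finset.univ.toList ++ amplified ω k)))

theorem numQueries_amplified (ω : ℕ → Circle) (k : ℕ) :
    numQueries (amplified hm E ω k) + 1 = 3 * 3 ^ k := by
  induction k with
  | zero => rw [amplified, numQueries_baseCircuit]; rfl
  | succ k ih =>
    have h : numQueries (hiddenPhase E (ω k) : List (Step n m N)) = 2 := rfl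
    rw [amplified, numQueries_append, numQueries_append, numQueries_append, numQueries_append,
      numQueries_invCircuit, numQueries_zeroPhase, h]
    omega

/-- A level triples the count and adds at most `2 + 10(n + m)` gates; the shift by half of this
makes the recursion geometric. -/
theorem numGates_amplified (ω : ℕ → Circle) (k : ℕ) :
    numGates (amplified hm E ω k) + (1 + 5 * (n + m)) ≤ 3 ^ k * (2 * n + 2 + 5 * (n + m)) := by
  induction k with
  | zero =>
    have h := numGates_baseCircuit hm (dataQubits E)
    rw [amplified]
    omega
  | succ k ih =>
    have h : numGates (hiddenPhase E (ω k) : List (Step n m N)) = 1 := rfl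
    have h1 := numGates_zeroPhase (n := n) (m := m) E (ω k) none Finset.univ.toList
    rw [Finset.length_toList, Finset.card_univ, Fintype.card_sum, Fintype.card_fin,
      Fintype.card_fin] at h1
    rw [amplified, numGates_append, numGates_append, numGates_append, numGates_append,
      numGates_invCircuit, h, pow_succ, mul_right_comm]
    omega

variable (U : QOp (Fin n ⊕ Fin m)) (a : Bits (Fin n))

theorem circuitOp_hiddenPhase (ω : Circle) :
    circuitOp U a (hiddenPhase E ω) = Matrix.diagonal fun z =>
      (phaseAt true ω (eqFlip a (eqQubits E) z (E (Sum.inr none))) : ℂ) := by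
  rw [← pullback_mul_diagonal_mul_pullback (eqFlip_involutive a (eqQubits E))
    (fun z => (phaseAt true ω (z (E (Sum.inr none))) : ℂ)), ← onWires_eqQuery, ← Step.op_phase U a]
  simp only [hiddenPhase, circuitOp, Matrix.one_mul, Matrix.mul_assoc]
  rfl

/-- The auxiliary qubits. -/
def auxQubits : Set (Fin N) := Set.range fun c => E (Sum.inr c)

theorem hiddenPhase_factor (ω : Circle) (z : Bits (Fin N)) (hz : ∀ q ∈ auxQubits E, z q = false) :
    (phaseAt true ω (eqFlip a (eqQubits E) z (E (Sum.inr none))) : ℂ) =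
      if (fun i => z (E (Sum.inl (Sum.inl i)))) = a then (ω : ℂ) else 1 := by
  have h1 : eqQubits E (Sum.inr 0) = E (Sum.inr none) := rfl
  have h2 : (fun i => z (eqQubits E (Sum.inl i))) = fun i => z (E (Sum.inl (Sum.inl i))) := rfl
  have h3 : z (E (Sum.inr none)) = false := hz _ ⟨none, rfl⟩
  rw [eqFlip, h1, h2]
  split_ifs <;> simp [phaseAt, h3]

/-- Surjectivity excludes idle qubits, which the ladder would not test. -/
theorem zeroPhase_factor (hE : Function.Surjective E) (ω : Circle) (z : Bits (Fin N))
    (hz : ∀ q ∈ auxQubits E, z q = false) :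
    (zeroPhaseValue E ω none Finset.univ.toList z : ℂ) =
      if z = fun _ => false then (ω : ℂ) else 1 := by
  have h : (z = fun _ => false) ↔
      (!z (E (Sum.inr none)) && Finset.univ.toList.all fun i => !z (E (Sum.inl i))) = true := by
    simp only [Bool.and_eq_true, Bool.not_eq_true', List.all_eq_true, Finset.mem_toList,
      Finset.mem_univ, true_imp_iff]
    refine ⟨fun h => by simp [h], fun h => funext fun q => ?_⟩
    obtain ⟨i | c, rfl⟩ := hE q
    · exact h.2 i
    · exact hz _ ⟨c, rfl⟩
  rw [zeroPhaseValue_eq]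
  · simp only [h, phaseAt]
    split_ifs <;> simp
  · exact List.nodup_cons.2 ⟨by simp,
      (Finset.nodup_toList _).map (Option.some_injective _)⟩
  · exact fun j _ => hz _ ⟨some j, rfl⟩

theorem circuitOp_amplified_succ (ω : ℕ → Circle) (k : ℕ) :
    circuitOp U a (amplified hm E ω (k + 1)) = circuitOp U a (amplified hm E ω k) *
      (Matrix.diagonal (fun z => (zeroPhaseValue E (ω k) none Finset.univ.toList z : ℂ)) *
      ((circuitOp U a (amplified hm E ω k))ᴴ * (Matrix.diagonal (fun z =>
        (phaseAt true (ω k) (eqFlip a (eqQubits E) z (E (Sum.inr none))) : ℂ)) *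
        circuitOp U a (amplified hm E ω k)))) := by
  have h : (none :: (Finset.univ : Finset (Fin n ⊕ Fin m)).toList.map some).Nodup :=
    List.nodup_cons.2 ⟨by simp, (Finset.nodup_toList _).map (Option.some_injective _)⟩
  rw [amplified, circuitOp_append, circuitOp_append, circuitOp_append, circuitOp_append,
    circuitOp_invCircuit, circuitOp_hiddenPhase, circuitOp_zeroPhase _ _ _ _ _ _ h]
  simp only [Matrix.mul_assoc]

theorem fixesWires_amplified (ω : ℕ → Circle) (k : ℕ) :
    FixesWires (auxQubits E) (circuitOp U a (amplified hm E ω k)) := by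
  induction k with
  | zero =>
    rw [amplified, circuitOp_baseCircuit]
    refine fixesWires_onWires _ ?_ _
    rintro i ⟨c, hc⟩
    exact Sum.inr_ne_inl (E.injective hc)
  | succ k ih =>
    rw [circuitOp_amplified_succ]
    exact ih.mul ((fixesWires_diagonal _ _).mul
      (ih.conjTranspose.mul ((fixesWires_diagonal _ _).mul ih)))

variable {hm U a}

theorem failProb_base {ε : ℝ} (hε : 0 ≤ ε) (h : IsIPQuery hm ε a U) :
    failProb (fun z => (fun i => z (E (Sum.inl (Sum.inl i)))) = a)
      (circuitOp U a (baseCircuit hm (dataQubits E))) (fun _ => false) ≤ 1 - 4 * ε ^ 2 := by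
  have hU := circuitOp_mem_unitaryGroup U a h.unitary (baseCircuit hm (dataQubits E))
  obtain ⟨α, hα, hamp⟩ := baseOp_apply h
  set w : Bits (Fin N) :=
    Function.extend (dataQubits E) (Sum.elim a fun _ => false) fun _ => false with hw
  have hw1 : ∀ i, w (dataQubits E i) = Sum.elim a (fun _ => false) i := fun i =>
    (dataQubits E).injective.extend_apply _ _ i
  have h1 : (circuitOp U a (baseCircuit hm (dataQubits E)) *ᵥ Pi.single (fun _ => false) 1) w =
      α := by
    rw [Matrix.mulVec_single_one, Matrix.col_apply, circuitOp_baseCircuit, onWires,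
      Matrix.of_apply, if_pos]
    · simp only [hw1]
      exact hamp
    · intro q hq
      exact Function.extend_apply' _ _ _ (by simpa using hq)
  have h2 := sum_good_eq (fun z => (fun i => z (E (Sum.inl (Sum.inl i)))) = a) hU fun _ => false
  have h3 : ‖(α : ℂ)‖ ^ 2 ≤ ∑ z with (fun i => z (E (Sum.inl (Sum.inl i)))) = a,
      ‖(circuitOp U a (baseCircuit hm (dataQubits E)) *ᵥ Pi.single (fun _ => false) 1) z‖ ^ 2 := by
    rw [← h1]
    refine Finset.single_le_sum (f := fun z => ‖(circuitOp U a (baseCircuit hm (dataQubits E)) *ᵥ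
      Pi.single (fun _ => false) 1) z‖ ^ 2) (fun _ _ => sq_nonneg _) ?_
    refine Finset.mem_filter.2 ⟨Finset.mem_univ _, funext fun i => ?_⟩
    exact hw1 (Sum.inl i)
  rw [h2, Complex.norm_real, Real.norm_eq_abs, sq_abs] at h3
  nlinarith

theorem failProb_amplified (hE : Function.Surjective E) {ε : ℝ} (hε : 0 ≤ ε)
    (h : IsIPQuery hm ε a U) {ω : ℕ → Circle}
    (hω : ∀ k, (1 - (ω k : ℂ)) ^ 2 = -((4 * Real.cosh (3 ^ k * ε) ^ 2 /
      (4 * Real.cosh (3 ^ k * ε) ^ 2 - 3) : ℝ) : ℂ) * ω k) (k : ℕ) :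
    Real.cosh (3 ^ k * ε) ^ 2 * failProb (fun z => (fun i => z (E (Sum.inl (Sum.inl i)))) = a)
      (circuitOp U a (amplified hm E ω k)) (fun _ => false) ≤ 1 := by
  induction k with
  | zero =>
    have h1 := failProb_base E hε h
    -- The initial parameter `cosh ε` is admissible because `cosh² ε ≤ exp(ε²)` and `1 - 4ε² ≤
    -- exp(-ε²)`.
    have h2 : Real.cosh ε ^ 2 ≤ Real.exp (ε ^ 2) := by
      have h3 := pow_le_pow_left₀ (Real.cosh_pos ε).le (Real.cosh_le_exp_half_sq ε) 2
      rw [← Real.exp_nat_mul] at h3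
      have h5 : ((2 : ℕ) : ℝ) * (ε ^ 2 / 2) = ε ^ 2 := by
        push_cast
        ring
      rwa [h5] at h3
    have h4 : 1 - 4 * ε ^ 2 ≤ Real.exp (-ε ^ 2) := by
      have := Real.add_one_le_exp (-ε ^ 2)
      nlinarith [sq_nonneg ε]
    rw [pow_zero, one_mul, amplified]
    calc _ ≤ Real.exp (ε ^ 2) * Real.exp (-ε ^ 2) :=
          mul_le_mul h2 (h1.trans h4) (failProb_nonneg _ _ _) (Real.exp_pos _).le
      _ = 1 := by rw [← Real.exp_add]; simp
  | succ k ih =>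
    rw [circuitOp_amplified_succ, failProb_amplification
      (circuitOp_mem_unitaryGroup U a h.unitary _) (fixesWires_amplified hm E U a ω k)
      (fun _ _ => rfl) (hω k) (hiddenPhase_factor E a (ω k)) (zeroPhase_factor E hE (ω k)),
      pow_succ' (3 : ℝ) k, mul_assoc 3, Real.cosh_three_mul]
    exact amplification_bound (Real.one_le_cosh _) ih

end Algorithm

/-- The least `k` for which `3 ^ k` reaches `L / ε` overshoots at most by a factor of `3`. -/
theorem exists_pow_three {L ε : ℝ} (hL : 1 ≤ L) (hε : 0 < ε) (hε' : ε ≤ 1 / 2) :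
    ∃ k : ℕ, L ≤ 3 ^ k * ε ∧ (3 : ℝ) ^ k ≤ 3 * L / ε := by
  have hex : ∃ k : ℕ, L ≤ 3 ^ k * ε := by
    obtain ⟨k, hk⟩ := pow_unbounded_of_one_lt (L / ε) (by norm_num : (1 : ℝ) < 3)
    exact ⟨k, by rw [div_lt_iff₀ hε] at hk; exact hk.le⟩
  classical
  refine ⟨Nat.find hex, Nat.find_spec hex, ?_⟩
  rw [le_div_iff₀ hε]
  rcases hk : Nat.find hex with _ | k
  · linarith
  · have h := Nat.find_min hex (m := k) (by omega)
    rw [pow_succ]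
    linarith [not_le.1 h]

theorem theorem2 (p : ℝ) (hp : p < 1) :
    ∃ K : ℝ, 0 < K ∧ ∀ (n m : ℕ) (_hn : 0 < n) (hm : 0 < m) (ε : ℝ) (_hε : 0 < ε),
      ∃ A : QueryAlgorithm n m,
        (A.queryCount : ℝ) ≤ K / ε ∧
        (A.auxCount : ℝ) ≤ K * ((n : ℝ) + (m : ℝ)) / ε ∧
        ∀ (a : Bits (Fin n)) (U : QOp (Fin n ⊕ Fin m)),
          IsIPQuery hm ε a U → p ≤ A.successProb U a := by
  have hp' : 0 < 1 - p := sub_pos.2 hp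
  -- Chosen so that `L ≥ 1` and a failure probability of at most `1 / L²` is at most `1 - p`.
  set L : ℝ := 1 + 1 / (1 - p) with hL
  have hL1 : 1 ≤ L := by rw [hL]; linarith [one_div_pos.2 hp']
  have hLp : 1 ≤ L ^ 2 * (1 - p) := by
    have h : 1 / (1 - p) * (1 - p) = 1 := by field_simp
    have h1 : L * (1 - p) = 1 - p + 1 := by rw [hL, add_mul, h, one_mul]
    nlinarith
  -- The constant is `3 · 8`: `3ᵏ ≤ 3L/ε`, and there are at most `8(n + m)` gates per unit of `3ᵏ`.
  -- The query count needs only `9L`.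
  refine ⟨24 * L, by linarith, fun n m hn hm ε hε => ?_⟩
  let E := Fintype.equivFin ((Fin n ⊕ Fin m) ⊕ Option (Fin n ⊕ Fin m))
  by_cases hε' : ε ≤ 1 / 2
  · choose ω hω using fun k : ℕ => exists_phase_of_one_le (Real.one_le_cosh (3 ^ k * ε))
    obtain ⟨k, hk, hk'⟩ := exists_pow_three hL1 hε hε'
    refine ⟨⟨_, amplified hm E.toEmbedding ω k,
      Function.Embedding.inl.trans (Function.Embedding.inl.trans E.toEmbedding)⟩, ?_, ?_, ?_⟩
    · have h := numQueries_amplified hm E.toEmbedding ω k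
      have h1 : (numQueries (amplified hm E.toEmbedding ω k) : ℝ) + 1 = 3 * 3 ^ k := by
        exact_mod_cast h
      change (numQueries (amplified hm E.toEmbedding ω k) : ℝ) ≤ _
      rw [le_div_iff₀ hε] at hk' ⊢
      nlinarith
    · have h := numGates_amplified hm E.toEmbedding ω k
      have h1 : numGates (amplified hm E.toEmbedding ω k) ≤ 3 ^ k * (8 * (n + m)) :=
        le_trans (by omega) (h.trans (Nat.mul_le_mul_left _ (by omega)))
      have h2 : (numGates (amplified hm E.toEmbedding ω k) : ℝ) ≤ 3 ^ k * (8 * (n + m)) := by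
        exact_mod_cast h1
      change (numGates (amplified hm E.toEmbedding ω k) : ℝ) ≤ _
      calc _ ≤ (3 : ℝ) ^ k * (8 * (n + m)) := h2
        _ ≤ 3 * L / ε * (8 * (n + m)) := by gcongr
        _ = 24 * L * (n + m) / ε := by ring
    · intro a U h
      have h1 := failProb_amplified E.toEmbedding E.surjective hε.le h hω k
      have h2 := sum_good_eq (fun z => (fun i => z (E (Sum.inl (Sum.inl i)))) = a)
        (circuitOp_mem_unitaryGroup U a h.unitary (amplified hm E.toEmbedding ω k)) fun _ => false
      have h3 : L ^ 2 ≤ Real.cosh (3 ^ k * ε) ^ 2 := by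
        refine pow_le_pow_left₀ (by linarith) ?_ 2
        -- `L ≤ t ≤ sinh t < cosh t` for `t = 3ᵏε`.
        exact hk.trans ((Real.self_le_sinh_iff.2 (by positivity)).trans (Real.sinh_lt_cosh _).le)
      rw [QueryAlgorithm.successProb]
      simp only [QueryAlgorithm.finalState, foldl_op_mulVec]
      refine le_trans ?_ h2.ge
      have h4 := failProb_nonneg (fun z => (fun i => z (E (Sum.inl (Sum.inl i)))) = a)
        (circuitOp U a (amplified hm E.toEmbedding ω k)) fun _ => false
      have h5 := (mul_le_mul_of_nonneg_right h3 h4).trans h1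
      nlinarith
  -- For `ε > 1/2` no query with this bias exists, as the base failure probability would be at most
  -- `1 - 4ε² < 0`; the empty circuit serves.
  · refine ⟨⟨n, [], Function.Embedding.refl _⟩, ?_, ?_, fun a U h => ?_⟩
    · simp only [QueryAlgorithm.queryCount, List.countP_nil, Nat.cast_zero]
      positivity
    · simp only [QueryAlgorithm.auxCount, List.countP_nil, Nat.cast_zero]
      positivity
    · have h1 := failProb_base E.toEmbedding hε.le h
      have h2 := failProb_nonneg (fun z => (fun i => z (E.toEmbedding (Sum.inl (Sum.inl i)))) = a)
        (circuitOp U a (baseCircuit hm (dataQubits E.toEmbedding))) fun _ => false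
      nlinarith
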